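/- Let $\rho = 1+\sqrt2$. Let $\pi^{(0)}$ be the empty vector, $\pi^{(1)} = [\sqrt2]$ and $\pi^{(m+1)} = [\pi^{(m)}, 1+\rho^{m-1}, \pi^{(m)}]$ for $m\ge 1$, so that $\pi^{(m)}\in\mathbb{R}^{2^m-1}$. Let $\gamma_m = \frac12\big(1+\sqrt{1+4\rho^m}\big)$ for $m \ge 0$, let $\underline{\pi}^{(m)} = [\gamma_m, \pi^{(m)}] \in \mathbb{R}^{2^m}$ be the left silver schedule, and let $T_m = 1+\gamma_m+\sum_{i=0}^{2^m-2}\pi^{(m)}_i$ (so $T_0 = 1+\gamma_0$). For $\lambda>0$ and a proper, closed, convex function $f:\mathbb{R}^d\to\mathbb{R}\cup\{\infty\}$ with a minimizer, let $\mathrm{Prox}_{\lambda f}(x) = \arg\min_{u}\{f(u)+\frac1{2\lambda}\|x-u\|^2\}$ and let $f^\lambda(x) = \min_{u}\{f(u)+\frac1{2\lambda}\|x-u\|^2\}$ be the Moreau envelope of $f$. The relaxed proximal point algorithm (RPPA) with schedule $\boldsymbol\alpha=(\alpha_0,\dots,\alpha_{N-1})$ and starting point $x^0$ generates $z^k = \mathrm{Prox}_{\lambda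 f}(x^k)$ for $0\le k\le N$ and $x^{k+1} = x^k+\alpha_k(z^k-x^k)$ for $0\le k<N$. **Theorem.** Let $m\ge 0$ and $N=2^m$. 1. Let $d \ge 0$ and let $f$, $\lambda$ be as above. Let $x^0\in\mathrm{dom}(f) = \{x : f(x)<\infty\}$ and let $x^\star$ be any minimizer of $f$. Then $f^\lambda$ is finite everywhere, $\mathrm{Prox}_{\lambda f}$ is well defined and single-valued on $\mathbb{R}^d$, and for the sequence generated by RPPA with schedule $\boldsymbol\alpha=\underline{\pi}^{(m)}$ started at $x^0$, $f^\lambda$ is differentiable at $x^N$ and $$\frac{\lambda}{2}\big\|\nabla f^\lambda(x^N)\big\|^2 \le \frac{1}{2T_m}\big(f(x^0)-f(x^\star)\big).$$ 2. The bound satisfies $\frac{1}{2T_m}\Delta \sim \frac{1}{2N^{\log_2\rho}}\Delta$ for every fixed $\Delta>0$, and $T_m\sim N^{\log_2\rho}$, where $N=2^m$ and $a_m\sim b_m$ means $\lim_{m\to\infty}a_m/b_m = 1$. 3. The bound is tight: for all $m\ge0$, $d\ge1$ and $\lambda>0$ there are a proper, closed, convex function $f:\mathbb{R}^d\to\mathbb{R}\cup\{\infty\}$,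 a minimizer $x^\star$ of $f$ and a point $x^0\in\mathrm{dom}(f)$ with $f(x^0)>f(x^\star)$ such that equality holds in the inequality of part 1. -/

import Mathlib

open Filter Topology

noncomputable section

namespace RPPA

/-- `ℝ^d` with the Euclidean norm. -/
abbrev Space (d : ℕ) : Type := EuclideanSpace ℝ (Fin d)

/-- `f : ℝ^d → ℝ ∪ {∞}` is proper, closed (lower semicontinuous) and convex. -/
structure ProperClosedConvex {d : ℕ} (f : Space d → EReal) : Prop where
  ne_bot : ∀ x, f x ≠ ⊥
  exists_ne_top : ∃ x, f x ≠ ⊤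
  closed : LowerSemicontinuous f
  convex : ∀ (x y : Space d) (a b : ℝ), 0 < a → 0 < b → a + b = 1 →
    f (a • x + b • y) ≤ (a : EReal) * f x + (b : EReal) * f y

/-- The function `u ↦ f u + ‖x - u‖² / (2 λ)` minimized by the proximal map at `x`. -/
def proxObjective {d : ℕ} (f : Space d → EReal) (lam : ℝ) (x u : Space d) : EReal :=
  f u + ((1 / (2 * lam) * ‖x - u‖ ^ 2 : ℝ) : EReal)

/-- `z = Prox_{λ f}(x)`, that is, `z` minimizes `f + ‖x - ·‖² / (2 λ)` over `ℝ^d`. -/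
def IsProx {d : ℕ} (f : Space d → EReal) (lam : ℝ) (x z : Space d) : Prop :=
  ∀ u, proxObjective f lam x z ≤ proxObjective f lam x u

/-- The Moreau envelope of `f`, with values in the extended reals. -/
def moreauEnvelope {d : ℕ} (f : Space d → EReal) (lam : ℝ) (x : Space d) : EReal :=
  ⨅ u, proxObjective f lam x u

/-- The Moreau envelope `f^λ` as a real function (it is finite for the functions at hand). -/
def envelope {d : ℕ} (f : Space d → EReal) (lam : ℝ) (x : Space d) : ℝ :=
  (moreauEnvelope f lam x).toReal

/-- `(x^k, z^k)`, `0 ≤ k ≤ N`, is generated by the relaxed proximal point algorithm with the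
relaxation schedule `α = (α_0, …, α_{N-1})`, where `N` is the length of `α`, from `x^0 = x0`.
Values of `x`, `z` at indices above `N` are irrelevant. -/
structure IsRun {d : ℕ} (f : Space d → EReal) (lam : ℝ) (α : List ℝ) (x0 : Space d)
    (x z : ℕ → Space d) : Prop where
  init : x 0 = x0
  prox : ∀ k ≤ α.length, IsProx f lam (x k) (z k)
  relax : ∀ (k : ℕ) (hk : k < α.length), x (k + 1) = x k + α[k] • (z k - x k)

/-- The silver ratio `ρ = 1 + √2`. -/
def rho : ℝ := 1 + Real.sqrt 2

/-- The silver schedule `π^(m)`, of length `2^m - 1`; the schedule `π^(0)` is empty. -/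
def silver : ℕ → List ℝ
  | 0 => []
  | 1 => [Real.sqrt 2]
  | m + 2 => silver (m + 1) ++ [1 + rho ^ m] ++ silver (m + 1)

/-- `γ_m`, the positive root of `γ² = γ + ρ^m`. -/
def gam (m : ℕ) : ℝ := (1 + Real.sqrt (1 + 4 * rho ^ m)) / 2

/-- The left silver schedule `[γ_m, π^(m)]`, which is `[γ_0]` for `m = 0`. -/
def leftSilver (m : ℕ) : List ℝ := gam m :: silver m

/-- `T_m = 1 + γ_m + ∑ π^(m)_i`, one plus the sum of the left silver schedule. -/
def T (m : ℕ) : ℝ := 1 + gam m + (silver m).sum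

theorem silver_length (m : ℕ) : (silver m).length + 1 = 2 ^ m := by
  induction m with
  | zero => simp [silver]
  | succ m ih =>
    cases m with
    | zero => simp [silver]
    | succ k =>
      have h : (2 : ℕ) ^ (k + 1 + 1) = 2 ^ (k + 1) + 2 ^ (k + 1) := by ring
      simp only [silver, List.length_append, List.length_cons, List.length_nil]
      omega

/-- The left silver schedule consists of `N = 2^m` steps. -/
theorem leftSilver_length (m : ℕ) : (leftSilver m).length = 2 ^ m := by
  simpa [leftSilver] using silver_length m

end RPPA

end

/-!
Write `g = x - z` for the displacement of a proximal step: up to the factor `λ` it is a subgradient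
of `f` at `z`, and `λ⁻¹ g` is the gradient of `f^λ` at `x`. A step with relaxation `1 + t` starts
the next proximal problem at `z - t g`, so squared distances to such points expand into inner
products that the subgradient inequality controls.

The silver schedule is handled by doubling. With `r = ρ^m`, two inequalities bounding `‖g‖²` at the
last proximal point, against an arbitrary comparison point `u`, survive joining two runs by a step
`1 + r / ρ`, with `r` replaced by `ρ r`; this is an identity in the field `ℚ(√2)` once the
inequalities at the two junction points are added up. The extra first step `γ_m` is chosen such that
`γ_m (γ_m - 1) = ρ^m`, which makes the coefficients of `f` and of `‖g‖²` at the first proximal point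
agree, and then `T_m = γ_m²`.

Equality holds for `f = ‖·‖` started so far out on a ray that the run walks along the ray and stops
at distance exactly `λ` from the origin.
-/

namespace RPPA

theorem sum_take_le_sum {M : Type*} [AddCommMonoid M] [Preorder M] [AddLeftMono M] {l : List M}
    (hl : ∀ a ∈ l, 0 ≤ a) (k : ℕ) : (l.take k).sum ≤ l.sum := by
  rw [← List.sum_take_add_sum_drop l k]
  exact le_add_of_nonneg_right (List.sum_nonneg fun a ha => hl a (List.mem_of_mem_drop ha))

theorem tendsto_sub_mul_add_mul_sq_atTop {𝕜 : Type*} [Field 𝕜] [LinearOrder 𝕜]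
    [IsStrictOrderedRing 𝕜] (a b : 𝕜) {c : 𝕜} (hc : 0 < c) :
    Tendsto (fun r : 𝕜 => a - b * r + c * r ^ 2) atTop atTop := by
  have hlin : Tendsto (fun r : 𝕜 => c * r + -b) atTop atTop :=
    tendsto_atTop_add_const_right _ _ (tendsto_id.const_mul_atTop hc)
  refine (tendsto_atTop_add_const_right _ a (tendsto_id.atTop_mul_atTop₀ hlin)).congr fun r => ?_
  simp only [id]
  ring

theorem exists_forall_le_of_lowerSemicontinuous {X β : Type*} [TopologicalSpace X] [LinearOrder β]
    {φ : X → β} (hφ : LowerSemicontinuous φ) {x₀ : X} (h : ∀ᶠ u in cocompact X, φ x₀ ≤ φ u) :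
    ∃ z, ∀ u, φ z ≤ φ u := by
  obtain ⟨K, hK, hKc⟩ := mem_cocompact.1 h
  obtain ⟨z, -, hz⟩ := (hφ.lowerSemicontinuousOn _).exists_isMinOn (Set.insert_nonempty x₀ K)
    (hK.insert x₀)
  refine ⟨z, fun u => ?_⟩
  by_cases hu : u ∈ K
  · exact hz (Set.mem_insert_of_mem x₀ hu)
  · exact (hz (Set.mem_insert x₀ K)).trans (hKc hu)

theorem sub_mul_norm_le_of_convexOn {E : Type*} [NormedAddCommGroup E] [NormedSpace ℝ E] {S : Set E}
    {F : E → ℝ} (hF : ConvexOn ℝ S F) {y u : E} (hy : y ∈ S) (hu : u ∈ S) {c : ℝ}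
    (hc : ∀ v ∈ S, ‖v - y‖ ≤ 1 → c ≤ F v) : c - (F y - c) * ‖u - y‖ ≤ F u := by
  have hgap : 0 ≤ F y - c := sub_nonneg.2 (hc y hy (by simp))
  rcases le_or_gt ‖u - y‖ 1 with hdist | hdist
  · linarith [hc u hu hdist, mul_nonneg hgap (norm_nonneg (u - y))]
  have hpos := one_pos.trans hdist
  have hinv : 0 ≤ 1 - ‖u - y‖⁻¹ := sub_nonneg.2 (inv_le_one_of_one_le₀ hdist.le)
  have hmem := hF.1 hy hu hinv (by positivity) (sub_add_cancel _ _)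
  have hconv := hF.2 hy hu hinv (by positivity) (sub_add_cancel _ _)
  have hunit : ‖(1 - ‖u - y‖⁻¹) • y + ‖u - y‖⁻¹ • u - y‖ ≤ 1 := by
    rw [show (1 - ‖u - y‖⁻¹) • y + ‖u - y‖⁻¹ • u - y = ‖u - y‖⁻¹ • (u - y) by module,
      norm_smul, norm_inv, norm_norm, inv_mul_cancel₀ hpos.ne']
  have hscaled := mul_le_mul_of_nonneg_left ((hc _ hmem hunit).trans hconv) hpos.le
  simp only [smul_eq_mul] at hscaled
  field_simp at hscaled
  linarith

section Subgradient

variable {E : Type*} [NormedAddCommGroup E] [InnerProductSpace ℝ E] {S : Set E} {F : E → ℝ}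
  {x z g : E}

theorem norm_sub_smul_sub_sq (z g u : E) (t : ℝ) :
    ‖z - t • g - u‖ ^ 2 = ‖z - u‖ ^ 2 + 2 * t * inner ℝ g (u - z) + t ^ 2 * ‖g‖ ^ 2 := by
  rw [show z - t • g - u = -((u - z) + t • g) by abel, norm_neg, norm_add_sq_real,
    inner_smul_right, norm_smul, mul_pow, Real.norm_eq_abs, sq_abs, real_inner_comm,
    norm_sub_rev u z]
  ring

theorem hasGradientAt_of_abs_sub_le_mul_norm_sq [CompleteSpace E] {φ : E → ℝ} {g x : E} {C : ℝ}
    (h : ∀ y, |φ y - φ x - inner ℝ g (y - x)| ≤ C * ‖y - x‖ ^ 2) : HasGradientAt φ g x := by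
  refine hasGradientAt_iff_isLittleO.2 (Asymptotics.IsBigO.trans_isLittleO
    (.of_bound C (.of_forall fun y => ?_)) (Asymptotics.isLittleO_pow_sub_sub x one_lt_two))
  simpa only [Real.norm_eq_abs, abs_pow, abs_norm] using h y

/-- `g` is a subgradient at `z` of the function that equals `F` on `S` and `∞` off `S`. -/
structure IsSubgradientAt (S : Set E) (F : E → ℝ) (g z : E) : Prop where
  mem : z ∈ S
  add_inner_le : ∀ u ∈ S, F z + inner ℝ g (u - z) ≤ F u

theorem IsSubgradientAt.inner_sub_sub_nonneg {g' z' : E} (h : IsSubgradientAt S F g z)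
    (h' : IsSubgradientAt S F g' z') : 0 ≤ inner ℝ (g - g') (z - z') := by
  have hz' := h.add_inner_le z' h'.mem
  have hz := h'.add_inner_le z h.mem
  rw [← neg_sub z z', inner_neg_right] at hz'
  rw [inner_sub_left]
  linarith

theorem IsSubgradientAt.eq_of_sub {z' : E} (h : IsSubgradientAt S F (x - z) z)
    (h' : IsSubgradientAt S F (x - z') z') : z = z' := by
  have hmono := h.inner_sub_sub_nonneg h'
  rw [sub_sub_sub_cancel_left, ← neg_sub z z', inner_neg_left, Left.nonneg_neg_iff] at hmono
  exact sub_eq_zero.1 (real_inner_self_nonpos.1 hmono)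

theorem add_inner_le_of_isMinOn_add_norm_sq (hF : ConvexOn ℝ S F) (hz : z ∈ S)
    (hmin : IsMinOn (fun u => F u + ‖x - u‖ ^ 2 / 2) S z) {u : E} (hu : u ∈ S) {t : ℝ}
    (ht₀ : 0 < t) (ht₁ : t ≤ 1) :
    F z + inner ℝ (x - z) (u - z) ≤ F u + t * (‖u - z‖ ^ 2 / 2) := by
  have hmem := hF.1 hz hu (sub_nonneg.2 ht₁) ht₀.le (sub_add_cancel 1 t)
  have hconv := hF.2 hz hu (sub_nonneg.2 ht₁) ht₀.le (sub_add_cancel 1 t)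
  have hle := isMinOn_iff.1 hmin _ hmem
  rw [show x - ((1 - t) • z + t • u) = (x - z) - t • (u - z) by module, norm_sub_sq_real (x - z),
    inner_smul_right, norm_smul, mul_pow, Real.norm_eq_abs, sq_abs] at hle
  rw [smul_eq_mul, smul_eq_mul] at hconv
  refine le_of_mul_le_mul_left ?_ ht₀
  linarith

theorem isSubgradientAt_sub_iff_isMinOn (hF : ConvexOn ℝ S F) :
    IsSubgradientAt S F (x - z) z ↔
      z ∈ S ∧ IsMinOn (fun u => F u + ‖x - u‖ ^ 2 / 2) S z := by
  refine ⟨fun h => ⟨h.mem, isMinOn_iff.2 fun u hu => ?_⟩, fun ⟨hz, hmin⟩ => ⟨hz, fun u hu => ?_⟩⟩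
  · have hle := h.add_inner_le u hu
    have hnorm := norm_sub_smul_sub_sq z (x - z) u (-1)
    rw [neg_one_smul, sub_neg_eq_add, add_sub_cancel] at hnorm
    linarith [sq_nonneg ‖z - u‖]
  · have hlim : Tendsto (fun t : ℝ => F u + t * (‖u - z‖ ^ 2 / 2)) (𝓝[>] 0) (𝓝 (F u)) :=
      (Continuous.tendsto' (by fun_prop) 0 _ (by simp)).mono_left nhdsWithin_le_nhds
    refine ge_of_tendsto hlim ?_
    filter_upwards [Ioc_mem_nhdsGT one_pos] with t ht
    exact add_inner_le_of_isMinOn_add_norm_sq hF hz hmin hu ht.1 ht.2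

end Subgradient

section SilverSchedule

theorem one_lt_rho : 1 < rho := by
  simp [rho]

theorem rho_pow_pos (m : ℕ) : 0 < rho ^ m :=
  pow_pos (zero_lt_one.trans one_lt_rho) m

theorem rho_mul_sqrt_two_sub_one : rho * (√2 - 1) = 1 := by
  rw [rho]
  linear_combination Real.sq_sqrt (zero_le_two (α := ℝ))

/-- The middle step `1 + ρ^(m-1)` is written with `√2 - 1 = ρ⁻¹`, so that no case distinction is
needed at `m = 0`. -/
theorem silver_succ (m : ℕ) :
    silver (m + 1) = silver m ++ (1 + rho ^ m * (√2 - 1)) :: silver m := by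
  cases m with
  | zero => simp [silver]
  | succ k =>
    rw [pow_succ, mul_assoc, rho_mul_sqrt_two_sub_one, mul_one]
    simp [silver]

theorem silver_sum (m : ℕ) : (silver m).sum = rho ^ m - 1 := by
  induction m with
  | zero => simp [silver]
  | succ m ih =>
    rw [silver_succ, List.sum_append, List.sum_cons, ih, pow_succ,
      show √2 = rho - 1 by rw [rho, add_sub_cancel_left]]
    ring

theorem silver_nonneg (m : ℕ) : ∀ a ∈ silver m, 0 ≤ a := by
  induction m with
  | zero => simp [silver]
  | succ m ih =>
    have hmid : 0 ≤ rho ^ m * (√2 - 1) :=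
      mul_nonneg (rho_pow_pos m).le (sub_nonneg.2 (Real.one_le_sqrt.2 one_le_two))
    simp only [silver_succ, List.mem_append, List.mem_cons]
    rintro a (ha | rfl | ha)
    exacts [ih a ha, by linarith, ih a ha]

theorem gam_sq (m : ℕ) : gam m ^ 2 = gam m + rho ^ m := by
  have hsqrt := Real.sq_sqrt (show 0 ≤ 1 + 4 * rho ^ m by linarith [rho_pow_pos m])
  rw [gam]
  linear_combination hsqrt / 4

theorem one_lt_gam (m : ℕ) : 1 < gam m := by
  have hsqrt : 1 < √(1 + 4 * rho ^ m) := by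
    rw [Real.lt_sqrt zero_le_one]
    linarith [rho_pow_pos m]
  rw [gam]
  linarith

theorem rho_pow_eq_gam_mul (m : ℕ) : rho ^ m = gam m * (gam m - 1) := by
  linear_combination -gam_sq m

theorem leftSilver_nonneg (m : ℕ) : ∀ a ∈ leftSilver m, 0 ≤ a :=
  List.forall_mem_cons.2 ⟨(zero_lt_one.trans (one_lt_gam m)).le, silver_nonneg m⟩

theorem one_add_leftSilver_sum (m : ℕ) : 1 + (leftSilver m).sum = T m := by
  rw [leftSilver, T, List.sum_cons, add_assoc]

theorem T_eq_gam_sq (m : ℕ) : T m = gam m ^ 2 := by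
  rw [T, silver_sum, gam_sq]
  ring

theorem T_pos (m : ℕ) : 0 < T m := by
  rw [T_eq_gam_sq]
  exact pow_pos (zero_lt_one.trans (one_lt_gam m)) 2

end SilverSchedule

section SilverRun

variable {E : Type*} [NormedAddCommGroup E] [InnerProductSpace ℝ E] {S : Set E} {F : E → ℝ}

/-- `RelaxedProxRun S F α x₀ x z` says that relaxed proximal steps for `F` on `S` with schedule `α`
lead from `x₀` to `x`, whose proximal point is `z`. The step size `λ` is absorbed into `F`, and a
proximal point is encoded by its optimality condition. -/
inductive RelaxedProxRun (S : Set E) (F : E → ℝ) : List ℝ → E → E → E → Prop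
  | nil {x z : E} (h : IsSubgradientAt S F (x - z) z) : RelaxedProxRun S F [] x x z
  | cons {α : List ℝ} {a : ℝ} {x₀ z₀ x z : E} (h : IsSubgradientAt S F (x₀ - z₀) z₀)
      (hrun : RelaxedProxRun S F α (x₀ + a • (z₀ - x₀)) x z) : RelaxedProxRun S F (a :: α) x₀ x z

theorem RelaxedProxRun.exists_of_append {α β : List ℝ} {b : ℝ} {x₀ x z : E}
    (h : RelaxedProxRun S F (α ++ b :: β) x₀ x z) :
    ∃ y w, RelaxedProxRun S F α x₀ y w ∧ RelaxedProxRun S F β (y + b • (w - y)) x z := by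
  induction α generalizing x₀ with
  | nil =>
    cases h with
    | cons hsub hrun => exact ⟨_, _, .nil hsub, hrun⟩
  | cons a α ih =>
    cases h with
    | cons hsub hrun =>
      obtain ⟨y, w, hα, hβ⟩ := ih hrun
      exact ⟨y, w, .cons hsub hα, hβ⟩

/-- The guarantee of rate `r` that a silver schedule yields, when started at `x₀`, for its last
proximal point `z` and the subgradient `g` at `z`. It is the induction hypothesis of the doubling
argument: neither inequality is preserved without the other. -/
structure SilverCertificate (S : Set E) (F : E → ℝ) (r : ℝ) (x₀ z g : E) : Prop where
  isSubgradientAt : IsSubgradientAt S F g z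
  norm_sq_le : ∀ u ∈ S, r ^ 2 * ‖g‖ ^ 2 + ‖z - u‖ ^ 2 ≤ ‖x₀ - u‖ ^ 2 + 2 * r * (F u - F z)
  two_mul_norm_sq_le : ∀ u ∈ S, 2 * r ^ 2 * ‖g‖ ^ 2 + ‖z - u‖ ^ 2 ≤
    ‖x₀ - u‖ ^ 2 + ‖x₀ - z‖ ^ 2 + 2 * r * (F u - F z)

theorem IsSubgradientAt.silverCertificate_one {x z : E} (h : IsSubgradientAt S F (x - z) z) :
    SilverCertificate S F 1 x z (x - z) := by
  have hnorm (u : E) (hu : u ∈ S) :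
      ‖x - z‖ ^ 2 + ‖z - u‖ ^ 2 ≤ ‖x - u‖ ^ 2 + 2 * (F u - F z) := by
    have hexp := norm_sub_smul_sub_sq z (x - z) u (-1)
    rw [neg_one_smul, sub_neg_eq_add, add_sub_cancel] at hexp
    linarith [h.add_inner_le u hu]
  exact ⟨h, fun u hu => by linarith [hnorm u hu], fun u hu => by linarith [hnorm u hu]⟩

theorem SilverCertificate.sq_mul_norm_sq_le {r t : ℝ} {z₀ g₀ z g : E}
    (h : SilverCertificate S F r (z₀ - t • g₀) z g) (h₀ : IsSubgradientAt S F g₀ z₀)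
    (ht : 0 ≤ t) :
    r ^ 2 * ‖g‖ ^ 2 ≤ (r - t) * (F z₀ - F z) + t ^ 2 * ‖g₀‖ ^ 2 := by
  have hcert := h.two_mul_norm_sq_le z₀ h₀.mem
  have hsub := mul_le_mul_of_nonneg_left (h₀.add_inner_le z h.isSubgradientAt.mem) ht
  rw [norm_sub_smul_sub_sq, norm_sub_smul_sub_sq, sub_self, inner_zero_right, norm_zero,
    norm_sub_rev z z₀] at hcert
  linarith

theorem SilverCertificate.glue {r : ℝ} {x₀ zA gA zB gB : E} (hr : 0 ≤ r)
    (hA : SilverCertificate S F r x₀ zA gA)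
    (hB : SilverCertificate S F r (zA - (r * (√2 - 1)) • gA) zB gB) :
    SilverCertificate S F (rho * r) x₀ zB gB := by
  have hsq : √2 ^ 2 = (2 : ℝ) := Real.sq_sqrt zero_le_two
  have hone : (1 : ℝ) ≤ √2 := Real.one_le_sqrt.2 one_le_two
  have ht : 0 ≤ r * (√2 - 1) := mul_nonneg hr (sub_nonneg.2 hone)
  have hjoin : r ^ 2 * (1 + √2) * ‖gB‖ ^ 2 ≤
      √2 * r * (F zA - F zB) + r ^ 2 * (√2 - 1) * ‖gA‖ ^ 2 := by
    have hscaled := mul_le_mul_of_nonneg_left (hB.sq_mul_norm_sq_le hA.isSubgradientAt ht)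
      (show 0 ≤ 1 + √2 by linarith)
    linear_combination hscaled + (-r * (F zA - F zB) + r ^ 2 * (√2 - 1) * ‖gA‖ ^ 2) * hsq
  have hsub (u : E) (hu : u ∈ S) := mul_le_mul_of_nonneg_left
    (hA.isSubgradientAt.add_inner_le u hu) ht
  refine ⟨hB.isSubgradientAt, fun u hu => ?_, fun u hu => ?_⟩
  · have hAu := hA.norm_sq_le u hu
    have hBu := hB.norm_sq_le u hu
    rw [norm_sub_smul_sub_sq] at hBu
    rw [rho]
    linear_combination hAu + hBu + 2 * hsub u hu + 2 * hjoin +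
      (r ^ 2 * ‖gA‖ ^ 2 + r ^ 2 * ‖gB‖ ^ 2) * hsq
  · have hAB := hA.norm_sq_le zB hB.isSubgradientAt.mem
    have hAu := hA.norm_sq_le u hu
    have hBu := hB.two_mul_norm_sq_le u hu
    rw [norm_sub_smul_sub_sq, norm_sub_smul_sub_sq] at hBu
    rw [rho]
    linear_combination hAB + hAu + hBu + 2 * hsub zB hB.isSubgradientAt.mem + 2 * hsub u hu +
      4 * hjoin + (2 * r ^ 2 * ‖gA‖ ^ 2 + 2 * r ^ 2 * ‖gB‖ ^ 2) * hsq

theorem RelaxedProxRun.silverCertificate {m : ℕ} {x₀ x z : E}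
    (h : RelaxedProxRun S F (silver m) x₀ x z) :
    SilverCertificate S F (rho ^ m) x₀ z (x - z) := by
  induction m generalizing x₀ x z with
  | zero =>
    cases h with
    | nil hsub => simpa using hsub.silverCertificate_one
  | succ m ih =>
    rw [silver_succ] at h
    obtain ⟨y, w, hA, hB⟩ := h.exists_of_append
    rw [show y + (1 + rho ^ m * (√2 - 1)) • (w - y) = w - (rho ^ m * (√2 - 1)) • (y - w) by
      module] at hB
    rw [pow_succ']
    exact (ih hA).glue (rho_pow_pos m).le (ih hB)

theorem RelaxedProxRun.T_mul_norm_sq_le {m : ℕ} {x₀ x z : E} (hx₀ : x₀ ∈ S)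
    (h : RelaxedProxRun S F (leftSilver m) x₀ x z) :
    T m * ‖x - z‖ ^ 2 ≤ F x₀ - F z := by
  cases h with
  | @cons _ _ _ z₀ _ _ hsub hrun =>
    have hgam := sub_pos.2 (one_lt_gam m)
    rw [show x₀ + gam m • (z₀ - x₀) = z₀ - (gam m - 1) • (x₀ - z₀) by module] at hrun
    have hcert := hrun.silverCertificate.sq_mul_norm_sq_le hsub hgam.le
    rw [rho_pow_eq_gam_mul] at hcert
    have hlast : gam m ^ 2 * ‖x - z‖ ^ 2 ≤ F z₀ - F z + ‖x₀ - z₀‖ ^ 2 := by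
      refine le_of_mul_le_mul_left ?_ (pow_pos hgam 2)
      linear_combination hcert
    have hfirst := hsub.add_inner_le x₀ hx₀
    rw [real_inner_self_eq_norm_sq] at hfirst
    rw [T_eq_gam_sq]
    linarith

end SilverRun

section Prox

variable {d : ℕ} {f : Space d → EReal} {lam : ℝ} {x z u : Space d}

/-- The effective domain `dom f = {x | f x < ∞}`. -/
def effDomain (f : Space d → EReal) : Set (Space d) := {x | f x ≠ ⊤}

theorem ProperClosedConvex.coe_toReal (hf : ProperClosedConvex f) (hu : u ∈ effDomain f) :
    ((f u).toReal : EReal) = f u :=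
  EReal.coe_toReal hu (hf.ne_bot u)

theorem ProperClosedConvex.convexOn_toReal (hf : ProperClosedConvex f) :
    ConvexOn ℝ (effDomain f) fun u => (f u).toReal := by
  have hle {x y : Space d} (hx : x ∈ effDomain f) (hy : y ∈ effDomain f) {a b : ℝ} (ha : 0 < a)
      (hb : 0 < b) (hab : a + b = 1) :
      f (a • x + b • y) ≤ ((a * (f x).toReal + b * (f y).toReal : ℝ) : EReal) := by
    rw [EReal.coe_add, EReal.coe_mul, EReal.coe_mul, hf.coe_toReal hx, hf.coe_toReal hy]
    exact hf.convex x y a b ha hb hab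
  have hconv : Convex ℝ (effDomain f) := convex_iff_forall_pos.2
    fun x hx y hy a b ha hb hab => ((hle hx hy ha hb hab).trans_lt (EReal.coe_lt_top _)).ne
  refine convexOn_iff_forall_pos.2 ⟨hconv, fun x hx y hy a b ha hb hab => ?_⟩
  rw [smul_eq_mul, smul_eq_mul, ← EReal.coe_le_coe_iff,
    hf.coe_toReal (hconv hx hy ha.le hb.le hab)]
  exact hle hx hy ha hb hab

theorem ProperClosedConvex.proxObjective_eq_coe (hf : ProperClosedConvex f)
    (hu : u ∈ effDomain f) :
    proxObjective f lam x u = (((f u).toReal + 1 / (2 * lam) * ‖x - u‖ ^ 2 : ℝ) : EReal) := by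
  rw [proxObjective, EReal.coe_add, hf.coe_toReal hu]

theorem proxObjective_eq_top (hu : u ∉ effDomain f) : proxObjective f lam x u = ⊤ := by
  rw [proxObjective, not_not.1 hu, EReal.top_add_coe]

theorem IsProx.mem_effDomain (hf : ProperClosedConvex f) (h : IsProx f lam x z) :
    z ∈ effDomain f := by
  obtain ⟨u, hu⟩ := hf.exists_ne_top
  by_contra hz
  have hle := h u
  rw [proxObjective_eq_top hz, hf.proxObjective_eq_coe hu, top_le_iff] at hle
  exact EReal.coe_ne_top _ hle

theorem isProx_iff_isMinOn (hf : ProperClosedConvex f) (hlam : 0 < lam) :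
    IsProx f lam x z ↔ z ∈ effDomain f ∧
      IsMinOn (fun u => lam * (f u).toReal + ‖x - u‖ ^ 2 / 2) (effDomain f) z := by
  have hiff (hz : z ∈ effDomain f) (u : Space d) (hu : u ∈ effDomain f) :
      proxObjective f lam x z ≤ proxObjective f lam x u ↔
        lam * (f z).toReal + ‖x - z‖ ^ 2 / 2 ≤ lam * (f u).toReal + ‖x - u‖ ^ 2 / 2 := by
    rw [hf.proxObjective_eq_coe hz, hf.proxObjective_eq_coe hu, EReal.coe_le_coe_iff,
      ← mul_le_mul_iff_right₀ hlam]
    field_simp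
  refine ⟨fun h => ?_, fun ⟨hz, hmin⟩ u => ?_⟩
  · have hz := h.mem_effDomain hf
    exact ⟨hz, isMinOn_iff.2 fun u hu => (hiff hz u hu).1 (h u)⟩
  · by_cases hu : u ∈ effDomain f
    · exact (hiff hz u hu).2 (isMinOn_iff.1 hmin u hu)
    · exact proxObjective_eq_top hu ▸ le_top

theorem isProx_iff_isSubgradientAt (hf : ProperClosedConvex f) (hlam : 0 < lam) :
    IsProx f lam x z ↔
      IsSubgradientAt (effDomain f) (fun u => lam * (f u).toReal) (x - z) z :=
  (isProx_iff_isMinOn hf hlam).trans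
    (isSubgradientAt_sub_iff_isMinOn (hf.convexOn_toReal.smul hlam.le)).symm

theorem IsProx.unique (hf : ProperClosedConvex f) (hlam : 0 < lam) {z' : Space d}
    (h : IsProx f lam x z) (h' : IsProx f lam x z') : z = z' :=
  ((isProx_iff_isSubgradientAt hf hlam).1 h).eq_of_sub ((isProx_iff_isSubgradientAt hf hlam).1 h')

theorem ProperClosedConvex.exists_sub_mul_norm_le (hf : ProperClosedConvex f) (x : Space d) :
    ∃ a b : ℝ, ∀ u ∈ effDomain f, a - b * ‖x - u‖ ≤ (f u).toReal := by
  obtain ⟨y, hy⟩ := hf.exists_ne_top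
  obtain ⟨w, -, hw⟩ := (hf.closed.lowerSemicontinuousOn (Metric.closedBall y 1)).exists_isMinOn
    ⟨y, Metric.mem_closedBall_self zero_le_one⟩ (isCompact_closedBall y 1)
  have hball (u : Space d) (hu : u ∈ effDomain f) (hdist : ‖u - y‖ ≤ 1) :
      (f w).toReal ≤ (f u).toReal :=
    EReal.toReal_le_toReal (hw (mem_closedBall_iff_norm.2 hdist)) (hf.ne_bot w) hu
  set b := (f y).toReal - (f w).toReal
  have hb : 0 ≤ b := sub_nonneg.2 (hball y hy (by simp))
  refine ⟨(f w).toReal - b * ‖x - y‖, b, fun u hu => ?_⟩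
  have hcenter : (f w).toReal - b * ‖u - y‖ ≤ (f u).toReal :=
    sub_mul_norm_le_of_convexOn hf.convexOn_toReal hy hu hball
  have htri := norm_sub_le_norm_sub_add_norm_sub u x y
  rw [norm_sub_rev u x] at htri
  linarith [mul_le_mul_of_nonneg_left htri hb]

theorem lowerSemicontinuous_proxObjective (hf : LowerSemicontinuous f) (lam : ℝ) (x : Space d) :
    LowerSemicontinuous (proxObjective f lam x) := by
  have hcont : Continuous fun u : Space d => ((1 / (2 * lam) * ‖x - u‖ ^ 2 : ℝ) : EReal) :=
    continuous_coe_real_ereal.comp (by fun_prop)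
  exact hf.add' hcont.lowerSemicontinuous fun u =>
    EReal.continuousAt_add (Or.inr (EReal.coe_ne_bot _)) (Or.inr (EReal.coe_ne_top _))

theorem ProperClosedConvex.exists_isProx (hf : ProperClosedConvex f) (hlam : 0 < lam)
    (x : Space d) : ∃ z, IsProx f lam x z := by
  obtain ⟨y, hy⟩ := hf.exists_ne_top
  obtain ⟨a, b, hab⟩ := hf.exists_sub_mul_norm_le x
  have hcoercive : ∀ᶠ u in cocompact (Space d), (f y).toReal + 1 / (2 * lam) * ‖x - y‖ ^ 2 ≤
      a - b * dist x u + 1 / (2 * lam) * dist x u ^ 2 :=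
    ((tendsto_sub_mul_add_mul_sq_atTop a b (by positivity)).comp
      (tendsto_dist_left_cocompact_atTop x)).eventually_ge_atTop _
  refine exists_forall_le_of_lowerSemicontinuous (x₀ := y)
    (lowerSemicontinuous_proxObjective hf.closed lam x) (hcoercive.mono fun u hle => ?_)
  by_cases hu : u ∈ effDomain f
  · rw [hf.proxObjective_eq_coe hy, hf.proxObjective_eq_coe hu, EReal.coe_le_coe_iff]
    rw [dist_eq_norm] at hle
    linarith [hab u hu]
  · exact proxObjective_eq_top hu ▸ le_top

theorem ProperClosedConvex.existsUnique_isProx (hf : ProperClosedConvex f) (hlam : 0 < lam)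
    (x : Space d) : ∃! z, IsProx f lam x z :=
  existsUnique_of_exists_of_unique (hf.exists_isProx hlam x) fun _ _ => IsProx.unique hf hlam

end Prox

section Envelope

variable {d : ℕ} {f : Space d → EReal} {lam : ℝ} {x z : Space d}

theorem IsProx.moreauEnvelope_eq (hf : ProperClosedConvex f) (h : IsProx f lam x z) :
    moreauEnvelope f lam x = (((f z).toReal + 1 / (2 * lam) * ‖x - z‖ ^ 2 : ℝ) : EReal) := by
  rw [← hf.proxObjective_eq_coe (h.mem_effDomain hf)]
  exact le_antisymm (iInf_le _ z) (le_iInf h)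

theorem ProperClosedConvex.moreauEnvelope_ne_bot_and_ne_top (hf : ProperClosedConvex f)
    (hlam : 0 < lam) (x : Space d) : moreauEnvelope f lam x ≠ ⊥ ∧ moreauEnvelope f lam x ≠ ⊤ := by
  obtain ⟨z, hz⟩ := hf.exists_isProx hlam x
  rw [hz.moreauEnvelope_eq hf]
  exact ⟨EReal.coe_ne_bot _, EReal.coe_ne_top _⟩

theorem IsProx.mul_envelope_eq (hf : ProperClosedConvex f) (hlam : 0 < lam)
    (h : IsProx f lam x z) : lam * envelope f lam x = lam * (f z).toReal + ‖x - z‖ ^ 2 / 2 := by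
  rw [envelope, h.moreauEnvelope_eq hf, EReal.toReal_coe]
  field_simp

theorem ProperClosedConvex.mul_envelope_le (hf : ProperClosedConvex f) (hlam : 0 < lam)
    {u : Space d} (hu : u ∈ effDomain f) :
    lam * envelope f lam x ≤ lam * (f u).toReal + ‖x - u‖ ^ 2 / 2 := by
  obtain ⟨z, hz⟩ := hf.exists_isProx hlam x
  rw [hz.mul_envelope_eq hf hlam]
  exact isMinOn_iff.1 ((isProx_iff_isMinOn hf hlam).1 hz).2 u hu

theorem IsProx.mul_envelope_le_add_inner (hf : ProperClosedConvex f) (hlam : 0 < lam)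
    (h : IsProx f lam x z) (y : Space d) :
    lam * envelope f lam y ≤
      lam * envelope f lam x + inner ℝ (x - z) (y - x) + ‖y - x‖ ^ 2 / 2 := by
  have hle := hf.mul_envelope_le hlam (x := y) (h.mem_effDomain hf)
  rw [← sub_add_sub_cancel y x z, norm_add_sq_real, real_inner_comm] at hle
  rw [h.mul_envelope_eq hf hlam]
  linarith

theorem IsProx.add_inner_le_mul_envelope (hf : ProperClosedConvex f) (hlam : 0 < lam)
    (h : IsProx f lam x z) (y : Space d) :
    lam * envelope f lam x + inner ℝ (x - z) (y - x) ≤ lam * envelope f lam y := by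
  obtain ⟨w, hw⟩ := hf.exists_isProx hlam y
  have hsub := ((isProx_iff_isSubgradientAt hf hlam).1 h).add_inner_le w (hw.mem_effDomain hf)
  have hsplit : inner ℝ (x - z) (y - w) =
      inner ℝ (x - z) (y - x) + ‖x - z‖ ^ 2 - inner ℝ (x - z) (w - z) := by
    rw [← real_inner_self_eq_norm_sq, ← inner_add_right, ← inner_sub_right]
    congr 1
    abel
  have hsq := norm_sub_sq_real (x - z) (y - w)
  rw [h.mul_envelope_eq hf hlam, hw.mul_envelope_eq hf hlam]
  linarith [sq_nonneg ‖x - z - (y - w)‖]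

theorem IsProx.hasGradientAt_envelope (hf : ProperClosedConvex f) (hlam : 0 < lam)
    (h : IsProx f lam x z) : HasGradientAt (envelope f lam) (lam⁻¹ • (x - z)) x := by
  refine hasGradientAt_of_abs_sub_le_mul_norm_sq (C := lam⁻¹ / 2) fun y => ?_
  have hlower := h.add_inner_le_mul_envelope hf hlam y
  have hupper := h.mul_envelope_le_add_inner hf hlam y
  rw [real_inner_smul_left, abs_le]
  constructor <;> refine le_of_mul_le_mul_left ?_ hlam <;> field_simp <;>
    linarith [sq_nonneg ‖y - x‖]

end Envelope

section UpperBound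

variable {d : ℕ} {f : Space d → EReal} {lam : ℝ}

theorem IsRun.relaxedProxRun (hf : ProperClosedConvex f) (hlam : 0 < lam) {α : List ℝ}
    {x₀ : Space d} {x z : ℕ → Space d} (h : IsRun f lam α x₀ x z) :
    RelaxedProxRun (effDomain f) (fun u => lam * (f u).toReal) α x₀ (x α.length)
      (z α.length) := by
  induction α generalizing x₀ x z with
  | nil =>
    rw [← h.init]
    exact .nil ((isProx_iff_isSubgradientAt hf hlam).1 (h.prox 0 le_rfl))
  | cons a α ih =>
    have htail : IsRun f lam α (x 1) (fun k => x (k + 1)) (fun k => z (k + 1)) :=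
      { init := rfl
        prox := fun k hk => h.prox (k + 1) (Nat.succ_le_succ hk)
        relax := fun k hk => h.relax (k + 1) (Nat.succ_lt_succ hk) }
    have hfirst : x 1 = x 0 + a • (z 0 - x 0) := h.relax 0 (Nat.succ_pos _)
    rw [← h.init]
    exact .cons ((isProx_iff_isSubgradientAt hf hlam).1 (h.prox 0 (Nat.zero_le _)))
      (hfirst ▸ ih htail)

theorem IsRun.hasGradientAt_envelope (hf : ProperClosedConvex f) (hlam : 0 < lam) {α : List ℝ}
    {x₀ : Space d} {x z : ℕ → Space d} (h : IsRun f lam α x₀ x z) :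
    HasGradientAt (envelope f lam) (lam⁻¹ • (x α.length - z α.length)) (x α.length) :=
  (h.prox _ le_rfl).hasGradientAt_envelope hf hlam

theorem IsRun.norm_gradient_envelope_sq_le (hf : ProperClosedConvex f) (hlam : 0 < lam) {m : ℕ}
    {x₀ : Space d} (hx₀ : x₀ ∈ effDomain f) {x z : ℕ → Space d}
    (h : IsRun f lam (leftSilver m) x₀ x z) :
    lam / 2 * ‖gradient (envelope f lam) (x (2 ^ m))‖ ^ 2 ≤
      1 / (2 * T m) * ((f x₀).toReal - (f (z (2 ^ m))).toReal) := by
  have hrun := (h.relaxedProxRun hf hlam).T_mul_norm_sq_le hx₀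
  have hgrad := h.hasGradientAt_envelope hf hlam
  rw [leftSilver_length] at hrun hgrad
  have hT := T_pos m
  rw [hgrad.gradient, norm_smul, norm_inv, Real.norm_of_nonneg hlam.le]
  field_simp
  linarith

end UpperBound

section Asymptotics

theorem two_pow_rpow_logb_rho (m : ℕ) : ((2 : ℝ) ^ m) ^ Real.logb 2 rho = rho ^ m := by
  rw [← Real.rpow_pow_comm zero_le_two,
    Real.rpow_logb two_pos (by norm_num) (zero_lt_one.trans one_lt_rho)]

theorem tendsto_gam_atTop : Tendsto gam atTop atTop := by
  have hsqrt : Tendsto (fun m : ℕ => √(1 + 4 * rho ^ m)) atTop atTop :=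
    Real.tendsto_sqrt_atTop.comp (tendsto_atTop_add_const_left _ 1
      ((tendsto_pow_atTop_atTop_of_one_lt one_lt_rho).const_mul_atTop four_pos))
  exact (tendsto_atTop_add_const_left _ 1 hsqrt).atTop_div_const two_pos

theorem tendsto_T_div_rho_pow : Tendsto (fun m : ℕ => T m / rho ^ m) atTop (𝓝 1) := by
  have hinv : Tendsto (fun m => 1 + (gam m - 1)⁻¹) atTop (𝓝 (1 + 0)) :=
    tendsto_const_nhds.add
      (tendsto_inv_atTop_zero.comp (tendsto_atTop_add_const_right _ (-1) tendsto_gam_atTop))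
  rw [add_zero] at hinv
  refine hinv.congr fun m => ?_
  have hgam := sub_pos.2 (one_lt_gam m)
  rw [T_eq_gam_sq, rho_pow_eq_gam_mul]
  field_simp
  ring

theorem tendsto_bound_div_bound {Δ : ℝ} (hΔ : Δ ≠ 0) :
    Tendsto (fun m : ℕ => (1 / (2 * T m) * Δ) / (1 / (2 * rho ^ m) * Δ)) atTop (𝓝 1) := by
  have hinv := tendsto_T_div_rho_pow.inv₀ one_ne_zero
  rw [inv_one] at hinv
  refine hinv.congr fun m => ?_
  have hT := T_pos m
  have hrho := rho_pow_pos m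
  field_simp

end Asymptotics

section Tightness

variable {d : ℕ} {lam : ℝ}

theorem properClosedConvex_norm (d : ℕ) :
    ProperClosedConvex (fun u : Space d => ((‖u‖ : ℝ) : EReal)) where
  ne_bot _ := EReal.coe_ne_bot _
  exists_ne_top := ⟨0, EReal.coe_ne_top _⟩
  closed := (continuous_coe_real_ereal.comp continuous_norm).lowerSemicontinuous
  convex x y a b ha hb _ := by
    rw [← EReal.coe_mul, ← EReal.coe_mul, ← EReal.coe_add, EReal.coe_le_coe_iff]
    refine (norm_add_le _ _).trans_eq ?_
    rw [norm_smul, norm_smul, Real.norm_of_nonneg ha.le, Real.norm_of_nonneg hb.le]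

theorem isProx_norm (hlam : 0 < lam) {c : ℝ} (hc : lam ≤ c) {e : Space d} (he : ‖e‖ = 1) :
    IsProx (fun u => ((‖u‖ : ℝ) : EReal)) lam (c • e) ((c - lam) • e) := by
  refine (isProx_iff_isSubgradientAt (properClosedConvex_norm d) hlam).2
    ⟨EReal.coe_ne_top _, fun u _ => ?_⟩
  have hinner : inner ℝ e u ≤ ‖u‖ := by simpa [he] using real_inner_le_norm e u
  simp only [EReal.toReal_coe]
  rw [← sub_smul, sub_sub_cancel, real_inner_smul_left, inner_sub_right, real_inner_smul_right,
    real_inner_self_eq_norm_sq, norm_smul, he, Real.norm_of_nonneg (sub_nonneg.2 hc)]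
  linarith [mul_le_mul_of_nonneg_left hinner hlam.le]

theorem isRun_norm (hlam : 0 < lam) {e : Space d} (he : ‖e‖ = 1) {α : List ℝ}
    (hα : ∀ a ∈ α, 0 ≤ a) :
    IsRun (fun u => ((‖u‖ : ℝ) : EReal)) lam α ((lam * (1 + α.sum)) • e)
      (fun k => (lam * (1 + α.sum - (α.take k).sum)) • e)
      (fun k => (lam * (1 + α.sum - (α.take k).sum) - lam) • e) where
  init := by simp
  prox k _ := isProx_norm hlam
    (le_mul_of_one_le_right hlam.le (by linarith [sum_take_le_sum hα k])) he
  relax k hk := by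
    rw [List.sum_take_succ _ _ hk]
    module

theorem exists_isRun_norm_gradient_envelope_sq_eq (m : ℕ) (hd : 0 < d) (hlam : 0 < lam) :
    ∃ (f : Space d → EReal) (x₀ xs : Space d) (x z : ℕ → Space d),
      ProperClosedConvex f ∧ (∀ y, f xs ≤ f y) ∧ f xs < f x₀ ∧ f x₀ < ⊤ ∧
      IsRun f lam (leftSilver m) x₀ x z ∧
      lam / 2 * ‖gradient (envelope f lam) (x (2 ^ m))‖ ^ 2 =
        1 / (2 * T m) * ((f x₀).toReal - (f xs).toReal) := by
  obtain ⟨e, he⟩ : ∃ e : Space d, ‖e‖ = 1 := ⟨EuclideanSpace.single ⟨0, hd⟩ 1, by simp⟩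
  have hrun := isRun_norm hlam he (leftSilver_nonneg m)
  have hgrad := hrun.hasGradientAt_envelope (properClosedConvex_norm d) hlam
  rw [← sub_smul, sub_sub_cancel, smul_smul, inv_mul_cancel₀ hlam.ne', one_smul,
    leftSilver_length] at hgrad
  have hT := T_pos m
  have hx₀ : ‖(lam * (1 + (leftSilver m).sum)) • e‖ = lam * T m := by
    rw [one_add_leftSilver_sum, norm_smul, he, mul_one, Real.norm_of_nonneg (by positivity)]
  refine ⟨_, _, 0, _, _, properClosedConvex_norm d, fun y => ?_, ?_, EReal.coe_lt_top _, hrun, ?_⟩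
  · exact EReal.coe_le_coe_iff.2 (by simp)
  · rw [EReal.coe_lt_coe_iff, hx₀, norm_zero]
    positivity
  · rw [hgrad.gradient, he, EReal.toReal_coe, EReal.toReal_coe, hx₀, norm_zero]
    field_simp
    ring

end Tightness

end RPPA

theorem mainTheorem4_general :
    (∀ (d : ℕ) (f : RPPA.Space d → EReal), RPPA.ProperClosedConvex f →
      ∀ (lam : ℝ), 0 < lam →
        (∀ y, RPPA.moreauEnvelope f lam y ≠ ⊥ ∧ RPPA.moreauEnvelope f lam y ≠ ⊤) ∧
        (∀ y, ∃! z, RPPA.IsProx f lam y z) ∧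
        ∀ (m : ℕ) (x0 : RPPA.Space d), f x0 < ⊤ →
        ∀ x z : ℕ → RPPA.Space d, RPPA.IsRun f lam (RPPA.leftSilver m) x0 x z →
          DifferentiableAt ℝ (RPPA.envelope f lam) (x (2 ^ m)) ∧
          ∀ xs : RPPA.Space d, f xs ≤ f (z (2 ^ m)) →
            lam / 2 * ‖gradient (RPPA.envelope f lam) (x (2 ^ m))‖ ^ 2 ≤
              1 / (2 * RPPA.T m) * ((f x0).toReal - (f xs).toReal)) ∧
    Tendsto (fun m : ℕ => RPPA.T m / ((2 : ℝ) ^ m) ^ Real.logb 2 RPPA.rho) atTop (𝓝 1) ∧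
    (∀ Δ : ℝ, 0 < Δ →
      Tendsto (fun m : ℕ => (1 / (2 * RPPA.T m) * Δ) /
        (1 / (2 * ((2 : ℝ) ^ m) ^ Real.logb 2 RPPA.rho) * Δ)) atTop (𝓝 1)) ∧
    (∀ (m d : ℕ), 0 < d → ∀ lam : ℝ, 0 < lam →
      ∃ (f : RPPA.Space d → EReal) (x0 xs : RPPA.Space d) (x z : ℕ → RPPA.Space d),
        RPPA.ProperClosedConvex f ∧ (∀ y, f xs ≤ f y) ∧ f xs < f x0 ∧ f x0 < ⊤ ∧
        RPPA.IsRun f lam (RPPA.leftSilver m) x0 x z ∧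
        lam / 2 * ‖gradient (RPPA.envelope f lam) (x (2 ^ m))‖ ^ 2 =
          1 / (2 * RPPA.T m) * ((f x0).toReal - (f xs).toReal)) := by
  simp only [RPPA.two_pow_rpow_logb_rho]
  refine ⟨fun d f hf lam hlam => ⟨hf.moreauEnvelope_ne_bot_and_ne_top hlam,
      hf.existsUnique_isProx hlam, fun m x0 hx0 x z hrun => ?_⟩,
    RPPA.tendsto_T_div_rho_pow, fun Δ hΔ => RPPA.tendsto_bound_div_bound hΔ.ne',
    fun m d hd lam hlam => RPPA.exists_isRun_norm_gradient_envelope_sq_eq m hd hlam⟩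
  have hN := RPPA.leftSilver_length m
  refine ⟨hN ▸ (hrun.hasGradientAt_envelope hf hlam).differentiableAt, fun xs hxs => ?_⟩
  have hvalue : (f xs).toReal ≤ (f (z (2 ^ m))).toReal :=
    EReal.toReal_le_toReal hxs (hf.ne_bot xs) ((hrun.prox _ hN.ge).mem_effDomain hf)
  have hT := RPPA.T_pos m
  exact (hrun.norm_gradient_envelope_sq_le hf hlam hx0.ne).trans (by gcongr)

theorem mainTheorem4 :
    -- the upper bound
    (∀ (d : ℕ) (f : RPPA.Space d → EReal), RPPA.ProperClosedConvex f →
      ∀ (lam : ℝ), 0 < lam →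
      ∀ xs : RPPA.Space d, (∀ y, f xs ≤ f y) →
      ∀ (m : ℕ) (x0 : RPPA.Space d), f x0 < ⊤ →
        -- the Moreau envelope is finite and the proximal map is well defined
        (∀ y, RPPA.moreauEnvelope f lam y ≠ ⊥ ∧ RPPA.moreauEnvelope f lam y ≠ ⊤) ∧
        (∀ y, ∃! z, RPPA.IsProx f lam y z) ∧
        ∀ x z : ℕ → RPPA.Space d, RPPA.IsRun f lam (RPPA.leftSilver m) x0 x z →
          DifferentiableAt ℝ (RPPA.envelope f lam) (x (2 ^ m)) ∧
          lam / 2 * ‖gradient (RPPA.envelope f lam) (x (2 ^ m))‖ ^ 2 ≤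
            1 / (2 * RPPA.T m) * ((f x0).toReal - (f xs).toReal)) ∧
    -- the asymptotics of the bound, with `N = 2 ^ m`
    Tendsto (fun m : ℕ => RPPA.T m / ((2 : ℝ) ^ m) ^ Real.logb 2 RPPA.rho) atTop (𝓝 1) ∧
    (∀ Δ : ℝ, 0 < Δ →
      Tendsto (fun m : ℕ => (1 / (2 * RPPA.T m) * Δ) /
        (1 / (2 * ((2 : ℝ) ^ m) ^ Real.logb 2 RPPA.rho) * Δ)) atTop (𝓝 1)) ∧
    -- tightness: the bound is attained by a nondegenerate instance
    (∀ (m d : ℕ), 0 < d → ∀ lam : ℝ, 0 < lam →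
      ∃ (f : RPPA.Space d → EReal) (x0 xs : RPPA.Space d) (x z : ℕ → RPPA.Space d),
        RPPA.ProperClosedConvex f ∧ (∀ y, f xs ≤ f y) ∧ f xs < f x0 ∧ f x0 < ⊤ ∧
        RPPA.IsRun f lam (RPPA.leftSilver m) x0 x z ∧
        lam / 2 * ‖gradient (RPPA.envelope f lam) (x (2 ^ m))‖ ^ 2 =
          1 / (2 * RPPA.T m) * ((f x0).toReal - (f xs).toReal)) := by
  obtain ⟨hbound, hasymptotics⟩ := mainTheorem4_general
  exact ⟨fun d f hf lam hlam xs hxs m x0 hx0 =>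
    ⟨(hbound d f hf lam hlam).1, (hbound d f hf lam hlam).2.1, fun x z hrun =>
      ((hbound d f hf lam hlam).2.2 m x0 hx0 x z hrun).imp_right fun h => h xs (hxs _)⟩,
    hasymptotics⟩
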